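/- **Theorem 1.2.** Let $G$ be a group and write $x^g = g^{-1}xg$ for $x,g\in G$. Call $a\in G$ a *strong left 3-Engel element* of $G$ if 1. $\langle a,a^g\rangle$ is nilpotent of class at most $2$ for all $g\in G$, and 2. $\langle a,a^f,a^g\rangle$ is nilpotent of class at most $3$ for all $f,g\in G$. If $a$ is a strong left 3-Engel element of $G$, then its normal closure $\langle a\rangle^G$ in $G$ is locally nilpotent, that is, every finitely generated subgroup of $\langle a\rangle^G$ is nilpotent. -/

import Mathlib

/-- A group is nilpotent of class at most `c`. -/
def NilpotentOfClassAtMost (H : Type*) [Group H] (c : ℕ) : Prop :=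
  Group.IsNilpotent H ∧ Group.nilpotencyClass H ≤ c

/-- A group is locally nilpotent if each of its finitely generated subgroups is nilpotent. -/
def IsLocallyNilpotentGroup (H : Type*) [Group H] : Prop :=
  ∀ K : Subgroup H, K.FG → Group.IsNilpotent K

/-- The right conjugate `a ^ g = g⁻¹ a g`. -/
def rightConj {G : Type*} [Group G] (a g : G) : G := g⁻¹ * a * g

/-- `a` is a strong left 3-Engel element of `G`: each `⟨a, a ^ g⟩` is nilpotent of class at most 2
and each `⟨a, a ^ f, a ^ g⟩` is nilpotent of class at most 3. -/
structure IsStrongLeftThreeEngel {G : Type*} [Group G] (a : G) : Prop where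
  class_two : ∀ g : G,
    NilpotentOfClassAtMost (Subgroup.closure {a, rightConj a g}) 2
  class_three : ∀ f g : G,
    NilpotentOfClassAtMost (Subgroup.closure {a, rightConj a f, rightConj a g}) 3

/-!
Call a subset `X` of a group, closed under inverses and conjugation, a *sandwich set* if for each
`x ∈ X` the conjugates of `x` by elements of `X` commute with one another. For a strong left 3-Engel
element `a`, the conjugates of the powers of `a` form such a set: `u * x * u⁻¹ = ⁅u, x⁆ * x`, the
condition on class two makes `x` commute with `⁅u, x⁆`, and the condition on class three makes
`⁅u, x⁆` commute with `⁅v, x⁆`. Everything else is about sandwich sets.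

A sandwich set remains one when the commutators of its elements are added
(`IsSandwichSet.union_comm`), so that it lies in a sandwich set `X` closed under commutators
(`IsSandwichSet.exists_comm_closed`). In such an `X` there is a Jacobi identity for `h`, `a`, `e` when
`h` and `e` commute (`IsSandwichSet.comm_comm_eq`), and the sandwich identity `⁅u, ⁅v, ⁅u, e⁆⁆⁆ = 1`
holds (`IsSandwichSet.commute_sandwich`).

The claim becomes that a group generated by finitely many elements `b c` of `X` is nilpotent
(`IsSandwichSet.isNilpotent`). Dividing out the union of the upper central series, one may assume
that the centre is trivial; it has to be shown that then all `b c` are trivial. Otherwise one can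
start from some `e ≠ 1` in `X` and commute for ever with generators, always taking the largest
generator not commuting with the element obtained so far, without ever reaching `1`. The words that
arise in this way form a set closed under factors whose words can be prolonged indefinitely. On the
one hand, such a set contains a word `x x`, `x v x` or `r y r` with letters `x`, `y` and Lyndon words `v`,
`r` (`IsLanguage.exists_sandwich`). On the other hand, the greedy choice and the Jacobi identity imply
that commuting successively with the letters of a Lyndon word amounts to commuting with a bracketing
of that word, which is a single element of `X` (`IsBracketing.greedy`). Hence the sandwich identity
turns each of these words into the trivial element, a contradiction.
-/

open scoped commutatorElement

/-! ### Sandwich sets -/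

/-- A set `X` containing `1`, closed under inverses and conjugation, is a *sandwich set* if for each
`x ∈ X` the conjugates of `x` by elements of `X` commute with one another. -/
structure IsSandwichSet {G : Type*} [Group G] (X : Set G) : Prop where
  one_mem' : (1 : G) ∈ X
  inv_mem' : ∀ {x}, x ∈ X → x⁻¹ ∈ X
  conj_mem' : ∀ {x}, x ∈ X → ∀ g : G, g * x * g⁻¹ ∈ X
  commute' : ∀ {x u v}, x ∈ X → u ∈ X → v ∈ X → Commute (u * x * u⁻¹) (v * x * v⁻¹)

section

variable {G : Type*} [Group G]

/-- The subgroup generated by the conjugates of `x` by the elements of `X`. -/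
def conjSpan (X : Set G) (x : G) : Subgroup G :=
  Subgroup.closure ((fun u => u * x * u⁻¹) '' X)

theorem commute_of_mem_conjSpan {X : Set G} {x : G}
    (hx : ∀ {u v}, u ∈ X → v ∈ X → Commute (u * x * u⁻¹) (v * x * v⁻¹)) {p q : G}
    (hp : p ∈ conjSpan X x) (hq : q ∈ conjSpan X x) : Commute p q := by
  have key : ∀ s ∈ (fun u => u * x * u⁻¹) '' X, ∀ t ∈ (fun u => u * x * u⁻¹) '' X,
      s * t = t * s := by
    rintro _ ⟨u, hu, rfl⟩ _ ⟨v, hv, rfl⟩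
    exact hx hu hv
  have h1 : conjSpan X x ≤ Subgroup.centralizer ((fun u => u * x * u⁻¹) '' X) :=
    (Subgroup.closure_le _).2 fun s hs => Subgroup.mem_centralizer_iff.2 fun t ht => key t ht s hs
  have h2 : conjSpan X x ≤ Subgroup.centralizer (conjSpan X x : Set G) :=
    (Subgroup.closure_le _).2 fun s hs => Subgroup.mem_centralizer_iff.2 fun t ht =>
      (Subgroup.mem_centralizer_iff.1 (h1 ht) s hs).symm
  exact (Subgroup.mem_centralizer_iff.1 (h2 hp) q hq).symm

theorem conj_mem_conjSpan {X : Set G} {x u : G} (hu : u ∈ X) : u * x * u⁻¹ ∈ conjSpan X x :=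
  Subgroup.subset_closure ⟨u, hu, rfl⟩

/-- Conjugation by a product `p * q` acts additively when `p` commutes with `q` and with the
conjugate of `q` by `x`. -/
theorem mul_conj_eq {p q x : G} (h₁ : Commute p q) (h₂ : Commute p (x * q * x⁻¹)) :
    p * q * x * (p * q)⁻¹ = q * x * q⁻¹ * x⁻¹ * (p * x * p⁻¹) := by
  have h : Commute p (q * (x * q * x⁻¹)⁻¹) := h₁.mul_right h₂.inv_right
  calc p * q * x * (p * q)⁻¹ = p * (q * (x * q * x⁻¹)⁻¹) * x * p⁻¹ := by group
    _ = (q * (x * q * x⁻¹)⁻¹) * p * x * p⁻¹ := by rw [h.eq]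
    _ = _ := by group

theorem comm_mul_eq_of_commute {x m r : G} (h : Commute x r) : ⁅x, m * r⁆ = ⁅x, m⁆ := by
  rw [commutatorElement_def, commutatorElement_def]
  calc x * (m * r) * x⁻¹ * (m * r)⁻¹ = x * m * (r * x⁻¹) * r⁻¹ * m⁻¹ := by group
    _ = x * m * (x⁻¹ * r) * r⁻¹ * m⁻¹ := by rw [h.inv_left.eq]
    _ = _ := by group

namespace IsSandwichSet

variable {X : Set G} (hX : IsSandwichSet X)
include hX

theorem commute_span {x p q : G} (hx : x ∈ X) (hp : p ∈ conjSpan X x) (hq : q ∈ conjSpan X x) :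
    Commute p q :=
  commute_of_mem_conjSpan (fun hu hv => hX.commute' hx hu hv) hp hq

theorem self_mem_span (x : G) : x ∈ conjSpan X x := by
  simpa using conj_mem_conjSpan (x := x) hX.one_mem'

theorem commute_conj {x u : G} (hx : x ∈ X) (hu : u ∈ X) : Commute x (u * x * u⁻¹) :=
  hX.commute_span hx (hX.self_mem_span x) (conj_mem_conjSpan hu)

/-- An element of `X` commutes even with its conjugates by products of two elements of `X`. -/
theorem commute_conj_mul {x u v : G} (hx : x ∈ X) (hu : u ∈ X) (hv : v ∈ X) :
    Commute x (u * v * x * (u * v)⁻¹) := by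
  have h := hX.commute' hx (hX.inv_mem' hu) hv
  rw [← Commute.conj_iff u] at h
  convert h using 1 <;> group

theorem comm_mem_span_left {a x : G} (ha : a ∈ X) : ⁅a, x⁆ ∈ conjSpan X x := by
  rw [show ⁅a, x⁆ = a * x * a⁻¹ * x⁻¹ from rfl]
  exact mul_mem (conj_mem_conjSpan ha) (inv_mem (hX.self_mem_span x))

theorem comm_mem_span_right {a x : G} (ha : a ∈ X) : ⁅x, a⁆ ∈ conjSpan X x := by
  rw [← commutatorElement_inv]
  exact inv_mem (hX.comm_mem_span_left ha)

theorem commute_comm_left {a x : G} (hx : x ∈ X) (ha : a ∈ X) : Commute x ⁅x, a⁆ :=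
  hX.commute_span hx (hX.self_mem_span x) (hX.comm_mem_span_right ha)

theorem commute_comm_right {a x : G} (hx : x ∈ X) (ha : a ∈ X) : Commute x ⁅a, x⁆ :=
  hX.commute_span hx (hX.self_mem_span x) (hX.comm_mem_span_left ha)

/-- Conjugation by a commutator of elements of `X` does not lead out of `conjSpan X x`. Here `x`
need not lie in `X`: the hypothesis is what remains of that. -/
theorem conj_comm_mem_span {x u v : G} (hu : u ∈ X) (hv : v ∈ X)
    (h : Commute u (x * v * u * (x * v)⁻¹)) :
    ⁅u, v⁆ * x * ⁅u, v⁆⁻¹ ∈ conjSpan X x := by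
  have h₁ : Commute u (v * u⁻¹ * v⁻¹) := by
    have := (hX.commute_conj hu hv).inv_right
    convert this using 1; group
  have h₂ : Commute u (x * (v * u⁻¹ * v⁻¹) * x⁻¹) := by
    have := h.inv_right
    convert this using 1; group
  rw [show ⁅u, v⁆ = u * (v * u⁻¹ * v⁻¹) by rw [commutatorElement_def]; group, mul_conj_eq h₁ h₂]
  exact mul_mem (mul_mem (conj_mem_conjSpan (hX.conj_mem' (hX.inv_mem' hu) v))
    (inv_mem (hX.self_mem_span x))) (conj_mem_conjSpan hu)

theorem conj_comm_mem_span_of_mem {x u v : G} (hx : x ∈ X) (hu : u ∈ X) (hv : v ∈ X) :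
    ⁅u, v⁆ * x * ⁅u, v⁆⁻¹ ∈ conjSpan X x :=
  hX.conj_comm_mem_span hu hv (hX.commute_conj_mul hu hx hv)

/-- Interchanging two adjacent conjugating letters changes the result by a factor lying in
`conjSpan X x`. -/
theorem conj_swap {x a b : G} (hx : x ∈ X) (ha : a ∈ X) (hb : b ∈ X) :
    a * b * x * (a * b)⁻¹ = b * a * x * (b * a)⁻¹ * (x⁻¹ * (⁅a, b⁆ * x * ⁅a, b⁆⁻¹)) := by
  have h₁ : Commute ⁅a, b⁆ ⁅a, x⁆ :=
    hX.commute_span ha (hX.comm_mem_span_right hb) (hX.comm_mem_span_right hx)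
  have h₂ : Commute ⁅a, b⁆ ⁅b, x⁆ :=
    hX.commute_span hb (hX.comm_mem_span_left ha) (hX.comm_mem_span_right hx)
  have h₃ : Commute ⁅a, b⁆ b := (hX.commute_comm_right hb ha).symm
  have h : Commute ⁅a, b⁆ (b * ⁅a, x⁆ * b⁻¹ * ⁅b, x⁆) :=
    ((h₃.mul_right h₁).mul_right h₃.inv_right).mul_right h₂
  calc a * b * x * (a * b)⁻¹
      = ⁅a, b⁆ * (b * ⁅a, x⁆ * b⁻¹ * ⁅b, x⁆) * x * ⁅a, b⁆⁻¹ := by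
        simp only [commutatorElement_def]; group
    _ = (b * ⁅a, x⁆ * b⁻¹ * ⁅b, x⁆) * ⁅a, b⁆ * x * ⁅a, b⁆⁻¹ := by rw [h.eq]
    _ = _ := by simp only [commutatorElement_def]; group

/-- The commutator of `x` with its conjugate by a product of three elements of `X` does not change
when the last two of them are interchanged. -/
theorem comm_conj_swap_right {x d a b : G} (hx : x ∈ X) (hd : d ∈ X) (ha : a ∈ X) (hb : b ∈ X) :
    ⁅x, d * a * b * x * (d * a * b)⁻¹⁆ = ⁅x, d * b * a * x * (d * b * a)⁻¹⁆ := by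
  have e : d * a * b * x * (d * a * b)⁻¹ = d * b * a * x * (d * b * a)⁻¹ *
      (d * (x⁻¹ * (⁅a, b⁆ * x * ⁅a, b⁆⁻¹)) * d⁻¹) := by
    calc _ = d * (a * b * x * (a * b)⁻¹) * d⁻¹ := by group
      _ = _ := by rw [hX.conj_swap hx ha hb]; group
  rw [e]
  apply comm_mul_eq_of_commute
  have h : Commute (d⁻¹ * x * d⁻¹⁻¹) (x⁻¹ * (⁅a, b⁆ * x * ⁅a, b⁆⁻¹)) :=
    hX.commute_span hx (conj_mem_conjSpan (hX.inv_mem' hd))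
      (mul_mem (inv_mem (hX.self_mem_span x)) (hX.conj_comm_mem_span_of_mem hx ha hb))
  rw [← Commute.conj_iff d] at h
  convert h using 1; group

/-- The commutator of `x` with its conjugate by a product of three elements of `X` does not change
when the first two of them are interchanged. -/
theorem comm_conj_swap_left {x d a b : G} (hx : x ∈ X) (hd : d ∈ X) (ha : a ∈ X) (hb : b ∈ X) :
    ⁅x, a * b * d * x * (a * b * d)⁻¹⁆ = ⁅x, b * a * d * x * (b * a * d)⁻¹⁆ := by
  have e : a * b * d * x * (a * b * d)⁻¹ = b * a * d * x * (b * a * d)⁻¹ *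
      ((d * x * d⁻¹)⁻¹ * (⁅a, b⁆ * (d * x * d⁻¹) * ⁅a, b⁆⁻¹)) := by
    calc _ = a * b * (d * x * d⁻¹) * (a * b)⁻¹ := by group
      _ = _ := by rw [hX.conj_swap (hX.conj_mem' hx d) ha hb]; group
  rw [e]
  apply comm_mul_eq_of_commute
  refine (hX.commute_conj hx hd).inv_right.mul_right ?_
  have h : Commute (⁅b, a⁆ * x * ⁅b, a⁆⁻¹) (d * x * d⁻¹) :=
    hX.commute_span hx (hX.conj_comm_mem_span_of_mem hx hb ha) (conj_mem_conjSpan hd)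
  rw [← Commute.conj_iff ⁅a, b⁆] at h
  rw [← commutatorElement_inv a b] at h
  have e' : ⁅a, b⁆ * (⁅a, b⁆⁻¹ * x * ⁅a, b⁆⁻¹⁻¹) * ⁅a, b⁆⁻¹ = x := by group
  rwa [e'] at h

/-- After conjugation by `(u * v)⁻¹` the commutator becomes that of `x` with a conjugate of `x` by a
product of three elements; `comm_conj_swap_right` and `comm_conj_swap_left` move `y` to the front
of this product, and the result visibly commutes with `y`. -/
theorem commute_comm_conj {x y u v : G} (hx : x ∈ X) (hy : y ∈ X) (hu : u ∈ X) (hv : v ∈ X) :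
    Commute (u * v * y * (u * v)⁻¹) ⁅u * v * x * (u * v)⁻¹, y * x * y⁻¹⁆ := by
  have hu' := hX.inv_mem' hu
  have hv' := hX.inv_mem' hv
  set h := v⁻¹ * u⁻¹ * x * (v⁻¹ * u⁻¹)⁻¹ with hh
  have hhX : h ∈ X := hX.conj_mem' hx _
  have e : ⁅x, v⁻¹ * u⁻¹ * y * x * (v⁻¹ * u⁻¹ * y)⁻¹⁆ = ⁅x, ⁅y, h⁆⁆ := by
    rw [hX.comm_conj_swap_right hx hv' hu' hy, hX.comm_conj_swap_left hx hu' hv' hy]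
    rw [show y * v⁻¹ * u⁻¹ * x * (y * v⁻¹ * u⁻¹)⁻¹ = ⁅y, h⁆ * h by
      rw [hh, commutatorElement_def]; group]
    exact comm_mul_eq_of_commute (hX.commute_conj_mul hx hv' hu')
  have h₁ : Commute y ⁅x, ⁅y, h⁆⁆ := by
    have a₁ : Commute y ⁅y, h⁆ := hX.commute_comm_left hy hhX
    have a₂ : Commute y (x * ⁅y, h⁆ * x⁻¹) := by
      have := (hX.commute_conj hy hx).mul_right (hX.commute_conj_mul hy hx hhX).inv_right
      have e' : x * y * x⁻¹ * (x * h * y * (x * h)⁻¹)⁻¹ = x * ⁅y, h⁆ * x⁻¹ := by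
        rw [commutatorElement_def]; group
      rwa [e'] at this
    exact a₂.mul_right a₁.inv_right
  rw [← e, ← Commute.conj_iff (u * v)] at h₁
  convert h₁ using 1
  simp only [commutatorElement_def]; group

end IsSandwichSet
end

/-! ### Closure under commutators -/

section

variable {G : Type*} [Group G]

namespace IsSandwichSet

variable {X : Set G} (hX : IsSandwichSet X)
include hX

theorem commute_comm_comm {x y u v : G} (hx : x ∈ X) (hy : y ∈ X) (hu : u ∈ X) (hv : v ∈ X) :
    Commute (u * v * y * (u * v)⁻¹) ⁅u * v * x * (u * v)⁻¹, ⁅y, x⁆⁆ := by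
  rw [show ⁅y, x⁆ = y * x * y⁻¹ * x⁻¹ from rfl,
    comm_mul_eq_of_commute (hX.commute_conj_mul hx hu hv).symm.inv_right]
  exact hX.commute_comm_conj hx hy hu hv

/-- A commutator of elements of `X` commutes with its conjugates by products of two elements of
`X`: these conjugates are again commutators `⁅x', y'⁆`, and `x' * y'` and `y' * x'` act on `⁅x, y⁆` in
the same way. -/
theorem commute_comm_conj_self {x y u v : G} (hx : x ∈ X) (hy : y ∈ X) (hu : u ∈ X)
    (hv : v ∈ X) : Commute ⁅x, y⁆ (u * v * ⁅x, y⁆ * (u * v)⁻¹) := by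
  set x' := u * v * x * (u * v)⁻¹ with hx'
  set y' := u * v * y * (u * v)⁻¹ with hy'
  set c := ⁅x, y⁆ with hc
  have hxX : x' ∈ X := hX.conj_mem' hx _
  have hyX : y' ∈ X := hX.conj_mem' hy _
  have e : u * v * c * (u * v)⁻¹ = ⁅x', y'⁆ := by
    rw [hc, hx', hy', commutatorElement_def, commutatorElement_def]; group
  have h₁ : Commute y' ⁅x', c⁻¹⁆ := by
    rw [hc, commutatorElement_inv]; exact hX.commute_comm_comm hx hy hu hv
  have h₂ : Commute x' ⁅y', c⁆ := hX.commute_comm_comm hy hx hu hv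
  -- both `x' * y'` and `y' * x'` conjugate `c` to `⁅y', c⁆ * c * ⁅x', c⁻¹⁆⁻¹`
  have e₁ : x' * y' * c * (x' * y')⁻¹ = ⁅y', c⁆ * c * ⁅x', c⁻¹⁆⁻¹ := by
    calc x' * y' * c * (x' * y')⁻¹ = x' * ⁅y', c⁆ * c * x'⁻¹ := by
          rw [commutatorElement_def]; group
      _ = ⁅y', c⁆ * x' * c * x'⁻¹ := by rw [h₂.eq]
      _ = _ := by rw [commutatorElement_def x' c⁻¹]; group
  have e₂ : y' * x' * c * (y' * x')⁻¹ = ⁅y', c⁆ * c * ⁅x', c⁻¹⁆⁻¹ := by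
    calc y' * x' * c * (y' * x')⁻¹ = y' * c * (⁅x', c⁻¹⁆⁻¹ * y'⁻¹) := by
          rw [commutatorElement_def]; group
      _ = y' * c * (y'⁻¹ * ⁅x', c⁻¹⁆⁻¹) := by rw [(h₁.inv_inv).eq]
      _ = _ := by rw [commutatorElement_def y' c]; group
  have h₃ : Commute ⁅x', y'⁆ (y' * x') :=
    ((hX.commute_comm_right hyX hxX).mul_left (hX.commute_comm_left hxX hyX)).symm
  have e₃ : (y' * x')⁻¹ * (x' * y') = ⁅x', y'⁆ := by
    have : x' * y' = ⁅x', y'⁆ * (y' * x') := by rw [commutatorElement_def]; group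
    rw [this, h₃.eq]; group
  rw [e, ← e₃]
  have e₄ := e₁.trans e₂.symm
  have : (y' * x')⁻¹ * (x' * y') * c = c * ((y' * x')⁻¹ * (x' * y')) := by
    calc _ = (y' * x')⁻¹ * (x' * y' * c * (x' * y')⁻¹) * (x' * y') := by group
      _ = _ := by rw [e₄]; group
  exact (show Commute _ _ from this).symm

theorem commute_conj_comm_conj_comm {x y u v : G} (hx : x ∈ X) (hy : y ∈ X) (hu : u ∈ X)
    (hv : v ∈ X) : Commute (u * ⁅x, y⁆ * u⁻¹) (v * ⁅x, y⁆ * v⁻¹) := by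
  have h := hX.commute_comm_conj_self hx hy (hX.inv_mem' hu) hv
  rw [← Commute.conj_iff u] at h
  rwa [show u * (u⁻¹ * v * ⁅x, y⁆ * (u⁻¹ * v)⁻¹) * u⁻¹ = v * ⁅x, y⁆ * v⁻¹ by group] at h

/-- Adding to a sandwich set all commutators of its elements gives a sandwich set. -/
theorem union_comm : IsSandwichSet (X ∪ {g | ∃ a ∈ X, ∃ b ∈ X, g = ⁅a, b⁆}) := by
  have hP : ∀ {x u v}, x ∈ X ∪ {g | ∃ a ∈ X, ∃ b ∈ X, g = ⁅a, b⁆} → u ∈ X → v ∈ X →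
      Commute (u * x * u⁻¹) (v * x * v⁻¹) := by
    rintro x u v (hx | ⟨a, ha, b, hb, rfl⟩) hu hv
    · exact hX.commute' hx hu hv
    · exact hX.commute_conj_comm_conj_comm ha hb hu hv
  have hE : ∀ {x u}, x ∈ X → u ∈ X ∪ {g | ∃ a ∈ X, ∃ b ∈ X, g = ⁅a, b⁆} →
      u * x * u⁻¹ ∈ conjSpan X x := by
    rintro x u hx (hu | ⟨a, ha, b, hb, rfl⟩)
    · exact conj_mem_conjSpan hu
    · exact hX.conj_comm_mem_span_of_mem hx ha hb
  have hcl : ∀ {x}, x ∈ X ∪ {g | ∃ a ∈ X, ∃ b ∈ X, g = ⁅a, b⁆} →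
      x⁻¹ ∈ X ∪ {g | ∃ a ∈ X, ∃ b ∈ X, g = ⁅a, b⁆} := by
    rintro x (hx | ⟨a, ha, b, hb, rfl⟩)
    · exact Or.inl (hX.inv_mem' hx)
    · exact Or.inr ⟨b, hb, a, ha, commutatorElement_inv a b⟩
  refine ⟨Or.inl hX.one_mem', hcl, ?_, ?_⟩
  · rintro x (hx | ⟨a, ha, b, hb, rfl⟩) g
    · exact Or.inl (hX.conj_mem' hx g)
    · refine Or.inr ⟨_, hX.conj_mem' ha g, _, hX.conj_mem' hb g, ?_⟩
      rw [commutatorElement_def, commutatorElement_def]; group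
  -- `hP` and `hE` treat conjugation of the new elements by old ones and of the old elements by new
  -- ones; with both, a new element conjugated by a new one stays in its `conjSpan`
  · intro x u v hx hu hv
    have hE' : ∀ {u}, u ∈ X ∪ {g | ∃ a ∈ X, ∃ b ∈ X, g = ⁅a, b⁆} →
        u * x * u⁻¹ ∈ conjSpan X x := by
      rintro u (hu | ⟨p, hp, q, hq, rfl⟩)
      · exact conj_mem_conjSpan hu
      · refine hX.conj_comm_mem_span hp hq ?_
        have h := hX.commute_span hp (hE hp (hcl hx)) (hE hp (Or.inl hq))
        rw [← Commute.conj_iff x] at h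
        rw [show x * (x⁻¹ * p * x⁻¹⁻¹) * x⁻¹ = p by group] at h
        rwa [show x * (q * p * q⁻¹) * x⁻¹ = x * q * p * (x * q)⁻¹ by group] at h
    exact commute_of_mem_conjSpan (hP hx) (hE' hu) (hE' hv)

/-- Each sandwich set is contained in a sandwich set which is closed under commutators. -/
theorem exists_comm_closed :
    ∃ Y : Set G, X ⊆ Y ∧ IsSandwichSet Y ∧ ∀ {a b}, a ∈ Y → b ∈ Y → ⁅a, b⁆ ∈ Y := by
  let F : ℕ → Set G := fun n => (fun S : Set G => S ∪ {g | ∃ a ∈ S, ∃ b ∈ S, g = ⁅a, b⁆})^[n] X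
  have hs : ∀ n, F (n + 1) = F n ∪ {g | ∃ a ∈ F n, ∃ b ∈ F n, g = ⁅a, b⁆} := fun n =>
    Function.iterate_succ_apply' _ n X
  have hF : ∀ n, IsSandwichSet (F n) := by
    intro n
    induction n with
    | zero => exact hX
    | succ n ih => rw [hs]; exact ih.union_comm
  have hm : Monotone F := monotone_nat_of_le_succ fun n => by
    rw [hs]; exact Set.subset_union_left
  refine ⟨⋃ n, F n, Set.subset_iUnion F 0, ⟨?_, ?_, ?_, ?_⟩, ?_⟩
  · exact Set.mem_iUnion.2 ⟨0, hX.one_mem'⟩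
  · intro x hx
    obtain ⟨n, hn⟩ := Set.mem_iUnion.1 hx
    exact Set.mem_iUnion.2 ⟨n, (hF n).inv_mem' hn⟩
  · intro x hx g
    obtain ⟨n, hn⟩ := Set.mem_iUnion.1 hx
    exact Set.mem_iUnion.2 ⟨n, (hF n).conj_mem' hn g⟩
  · intro x u v hx hu hv
    obtain ⟨i, hi⟩ := Set.mem_iUnion.1 hx
    obtain ⟨j, hj⟩ := Set.mem_iUnion.1 hu
    obtain ⟨k, hk⟩ := Set.mem_iUnion.1 hv
    have h₁ : i ≤ max i (max j k) := le_max_left _ _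
    have h₂ : j ≤ max i (max j k) := (le_max_left _ _).trans (le_max_right _ _)
    have h₃ : k ≤ max i (max j k) := (le_max_right _ _).trans (le_max_right _ _)
    exact (hF _).commute' (hm h₁ hi) (hm h₂ hj) (hm h₃ hk)
  · intro a b ha hb
    obtain ⟨i, hi⟩ := Set.mem_iUnion.1 ha
    obtain ⟨j, hj⟩ := Set.mem_iUnion.1 hb
    refine Set.mem_iUnion.2 ⟨max i j + 1, ?_⟩
    rw [hs]
    exact Or.inr ⟨a, hm (le_max_left _ _) hi, b, hm (le_max_right _ _) hj, rfl⟩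

/-- The Jacobi identity for elements of a sandwich set closed under commutators. -/
theorem comm_comm_eq (hc : ∀ {a b}, a ∈ X → b ∈ X → ⁅a, b⁆ ∈ X) {e a h : G} (he : e ∈ X)
    (ha : a ∈ X) (hh : h ∈ X) (heh : Commute h e) : ⁅h, ⁅a, e⁆⁆ = ⁅⁅h, a⁆, e⁆ := by
  have h₁ : Commute ⁅h, a⁆ ⁅a, e⁆ :=
    hX.commute_span ha (hX.comm_mem_span_left hh) (hX.comm_mem_span_right he)
  have h₂ : Commute ⁅a, e⁆ ⁅⁅h, a⁆, e⁆ :=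
    hX.commute_span he (hX.comm_mem_span_left ha) (hX.comm_mem_span_left (hc hh ha))
  have h₃ : h * e⁻¹ * h⁻¹ = e⁻¹ := by rw [heh.inv_right.eq]; group
  calc ⁅h, ⁅a, e⁆⁆ = h * a * h⁻¹ * (h * e⁻¹ * h⁻¹)⁻¹ * (h * a * h⁻¹)⁻¹ * (h * e⁻¹ * h⁻¹) *
        ⁅a, e⁆⁻¹ := by simp only [commutatorElement_def]; group
    _ = ⁅h, a⁆ * ⁅a, e⁆ * e * ⁅h, a⁆⁻¹ * e⁻¹ * ⁅a, e⁆⁻¹ := by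
        rw [h₃]; simp only [commutatorElement_def]; group
    _ = ⁅a, e⁆ * ⁅⁅h, a⁆, e⁆ * ⁅a, e⁆⁻¹ := by
        rw [h₁.eq]; simp only [commutatorElement_def]; group
    _ = _ := by rw [h₂.eq]; group

/-- The sandwich property: `⁅v, ⁅u, e⁆⁆` commutes with `u`. -/
theorem commute_sandwich {e u v : G} (he : e ∈ X) (hu : u ∈ X) (hv : v ∈ X) :
    Commute u ⁅v, ⁅u, e⁆⁆ := by
  have h₁ : Commute u ⁅u, e⁆ := hX.commute_comm_left hu he
  have h₂ : Commute u (v * ⁅u, e⁆ * v⁻¹) := by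
    have := (hX.commute_conj hu hv).mul_right (hX.commute_conj_mul hu hv he).inv_right
    rwa [show v * u * v⁻¹ * (v * e * u * (v * e)⁻¹)⁻¹ = v * ⁅u, e⁆ * v⁻¹ by
      rw [commutatorElement_def]; group] at this
  exact h₂.mul_right h₁.inv_right

end IsSandwichSet
end

/-! ### Languages and Lyndon words -/

section

variable {α : Type*}

/-- A *language*: a set of words closed under factors in which each word can be prolonged on the
right. -/
structure IsLanguage (S : Set (List α)) : Prop where
  nil_mem : [] ∈ S
  left_mem : ∀ {u v}, u ++ v ∈ S → u ∈ S
  right_mem : ∀ {u v}, u ++ v ∈ S → v ∈ S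
  extend : ∀ {u}, u ∈ S → ∃ a, u ++ [a] ∈ S

theorem IsLanguage.infix_mem {S : Set (List α)} (hS : IsLanguage S) {u v : List α} (h : u <:+: v)
    (hv : v ∈ S) : u ∈ S := by
  obtain ⟨p, q, rfl⟩ := h
  exact hS.right_mem (hS.left_mem hv)

/-- By compactness, each language over a finite alphabet contains a minimal one. -/
theorem IsLanguage.exists_minimal [Finite α] {S : Set (List α)} (hS : IsLanguage S) :
    ∃ T ⊆ S, IsLanguage T ∧ ∀ U ⊆ T, IsLanguage U → U = T := by
  obtain ⟨T, hTS, hT⟩ := zorn_superset_nonempty {T : Set (List α) | IsLanguage T} (by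
    intro c hc hch hne
    refine ⟨⋂₀ c, ⟨?_, ?_, ?_, ?_⟩, fun s hs => Set.sInter_subset_of_mem hs⟩
    · exact Set.mem_sInter.2 fun s hs => (hc hs).nil_mem
    · exact fun h => Set.mem_sInter.2 fun s hs => (hc hs).left_mem (Set.mem_sInter.1 h s hs)
    · exact fun h => Set.mem_sInter.2 fun s hs => (hc hs).right_mem (Set.mem_sInter.1 h s hs)
    · intro u hu
      by_contra! hcon
      have : ∀ a, ∃ s : c, u ++ [a] ∉ s.1 := by
        intro a
        have := hcon a
        rw [Set.mem_sInter] at this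
        push Not at this
        obtain ⟨s, hs, h⟩ := this
        exact ⟨⟨s, hs⟩, h⟩
      choose f hf using this
      have : Nonempty c := hne.to_subtype
      have hd : Directed (· ≥ ·) (fun s : c => s.1) := by
        intro s t
        rcases hch.total s.2 t.2 with h | h
        · exact ⟨s, le_rfl, h⟩
        · exact ⟨t, h, le_rfl⟩
      have := Fintype.ofFinite α
      classical
      obtain ⟨z, hz⟩ := hd.finset_le (Finset.univ.image f)
      obtain ⟨a, ha⟩ := (hc z.2).extend (Set.mem_sInter.1 hu z.1 z.2)
      exact hf a (hz (f a) (Finset.mem_image_of_mem f (Finset.mem_univ a)) ha)) S hS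
  exact ⟨T, hTS, hT.1, fun U hU hL => le_antisymm hU (hT.2 hL hU)⟩

/-- In a minimal language each word is a factor of all sufficiently long words. -/
theorem IsLanguage.exists_recurrence [Finite α] {S : Set (List α)} (hS : IsLanguage S)
    (hmin : ∀ U ⊆ S, IsLanguage U → U = S) {s : List α} (hs : s ∈ S) :
    ∃ N, ∀ w ∈ S, N ≤ w.length → s <:+: w := by
  -- otherwise the words with arbitrarily long prolongations avoiding `s` form a smaller language
  by_contra! hcon
  let U : Set (List α) := {u | ∀ N, ∃ w, N ≤ w.length ∧ u ++ w ∈ S ∧ ¬ s <:+: u ++ w}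
  have hU : IsLanguage U := by
    refine ⟨?_, ?_, ?_, ?_⟩
    · intro N
      obtain ⟨w, hw, hN, h⟩ := hcon N
      exact ⟨w, hN, hw, h⟩
    · intro u v h N
      obtain ⟨w, hN, hw, h⟩ := h N
      exact ⟨v ++ w, by simp; omega, by rwa [← List.append_assoc], by rwa [← List.append_assoc]⟩
    · intro u v h N
      obtain ⟨w, hN, hw, h⟩ := h N
      rw [List.append_assoc] at hw h
      exact ⟨w, hN, hS.right_mem hw, fun h' => h (h'.trans (List.suffix_append _ _).isInfix)⟩
    · intro u h
      by_contra! hno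
      have : ∀ a, ∃ N, ∀ w, N ≤ w.length → u ++ [a] ++ w ∈ S → s <:+: u ++ [a] ++ w := by
        intro a
        by_contra! h'
        exact hno a h'
      choose f hf using this
      obtain ⟨M, hM⟩ := (Set.finite_range f).bddAbove
      obtain ⟨w, hN, hw, h⟩ := h (M + 1)
      cases w with
      | nil => simp at hN
      | cons a w =>
        have hfa : f a ≤ M := hM ⟨a, rfl⟩
        simp only [List.length_cons] at hN
        have := hf a w (by omega) (by simpa using hw)
        exact h (by simpa using this)
  have hUS : U ⊆ S := fun u hu => by
    obtain ⟨w, -, hw, -⟩ := hu 0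
    exact hS.left_mem hw
  have : s ∈ U := by rw [hmin U hUS hU]; exact hs
  obtain ⟨w, -, -, h⟩ := this 0
  exact h (List.prefix_append s w).isInfix

end

section

variable {α : Type*} [LinearOrder α]

/-- `FirstLess u v`: the words `u` and `v` differ in some position, and `u` has the smaller letter
in the first such position. For words neither of which is a prefix of the other this is the strict
lexicographic order. -/
def FirstLess (u v : List α) : Prop :=
  ∃ q a b, a < b ∧ q ++ [a] <+: u ∧ q ++ [b] <+: v

/-- A word is *Lyndon* if it is not empty and strictly smaller than each of its proper nonempty
suffixes. A suffix of `v` which is a prefix of `v` is not strictly larger than `v`, so that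
comparison at the first difference suffices. -/
def IsLyndon (v : List α) : Prop :=
  v ≠ [] ∧ ∀ p r, p ≠ [] → r ≠ [] → v = p ++ r → FirstLess v r

theorem FirstLess.mono {u v u' v' : List α} (h : FirstLess u v) (hu : u <+: u') (hv : v <+: v') :
    FirstLess u' v' := by
  obtain ⟨q, a, b, hab, h₁, h₂⟩ := h
  exact ⟨q, a, b, hab, h₁.trans hu, h₂.trans hv⟩

theorem FirstLess.trans {u v w : List α} (h : FirstLess u v) (h' : FirstLess v w) :
    FirstLess u w := by
  obtain ⟨q, a, b, hab, h₁, h₂⟩ := h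
  obtain ⟨q', a', b', hab', h₁', h₂'⟩ := h'
  rcases lt_trichotomy q.length q'.length with hl | hl | hl
  · have h₃ : q ++ [b] <+: q' :=
      List.prefix_of_prefix_length_le h₂ ((List.prefix_append q' [a']).trans h₁') (by simp; omega)
    exact ⟨q, a, b, hab, h₁, h₃.trans ((List.prefix_append q' [b']).trans h₂')⟩
  · have h₃ : q ++ [b] <+: q' ++ [a'] := List.prefix_of_prefix_length_le h₂ h₁' (by simp; omega)
    have h₄ := h₃.eq_of_length (by simp; omega)
    obtain ⟨rfl, h₅⟩ := List.append_inj h₄ hl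
    obtain rfl : b = a' := by simpa using h₅
    exact ⟨q, a, b', hab.trans hab', h₁, h₂'⟩
  · have h₃ : q' ++ [a'] <+: q :=
      List.prefix_of_prefix_length_le h₁' ((List.prefix_append q [b]).trans h₂) (by simp; omega)
    exact ⟨q', a', b', hab', h₃.trans ((List.prefix_append q [a]).trans h₁), h₂'⟩

theorem firstLess_irrefl (u : List α) : ¬ FirstLess u u := by
  rintro ⟨q, a, b, hab, h₁, h₂⟩
  have h₃ := (List.prefix_of_prefix_length_le h₁ h₂ (by simp)).eq_of_length (by simp)
  simp only [List.append_cancel_left_eq, List.cons.injEq, and_true] at h₃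
  exact hab.ne h₃

theorem firstLess_cons {x : α} {u v : List α} :
    FirstLess (x :: u) (x :: v) ↔ FirstLess u v := by
  constructor
  · rintro ⟨q, a, b, hab, h₁, h₂⟩
    cases q with
    | nil =>
      simp only [List.nil_append, List.cons_prefix_cons, List.nil_prefix, and_true] at h₁ h₂
      exact absurd (h₁.trans h₂.symm) hab.ne
    | cons y q =>
      simp only [List.cons_append, List.cons_prefix_cons] at h₁ h₂
      exact ⟨q, a, b, hab, h₁.2, h₂.2⟩
  · rintro ⟨q, a, b, hab, h₁, h₂⟩
    exact ⟨x :: q, a, b, hab, by simpa using h₁, by simpa using h₂⟩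

theorem firstLess_append_left {p u v : List α} :
    FirstLess (p ++ u) (p ++ v) ↔ FirstLess u v := by
  induction p with
  | nil => rfl
  | cons x p ih => rw [List.cons_append, List.cons_append, firstLess_cons, ih]

theorem firstLess_or_prefix (u v : List α) :
    FirstLess u v ∨ FirstLess v u ∨ u <+: v ∨ v <+: u := by
  induction u generalizing v with
  | nil => simp
  | cons x u ih =>
    cases v with
    | nil => simp
    | cons y v =>
      rcases lt_trichotomy x y with h | rfl | h
      · exact Or.inl ⟨[], x, y, h, by simp, by simp⟩
      · simpa [firstLess_cons] using ih v
      · exact Or.inr (Or.inl ⟨[], y, x, h, by simp, by simp⟩)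

theorem firstLess_of_length_eq {u v : List α} (hl : u.length = v.length) (hne : u ≠ v)
    (h : ¬ FirstLess u v) : FirstLess v u := by
  rcases firstLess_or_prefix u v with h' | h' | h' | h'
  · exact absurd h' h
  · exact h'
  · exact absurd (h'.eq_of_length hl) hne
  · exact absurd (h'.eq_of_length hl.symm).symm hne

/-- A word which is larger than `W` at the first difference is still so after removing a common
prefix, or its initial part already is. -/
theorem FirstLess.append_cases {W v₁ v₂ : List α} (h : FirstLess W (v₁ ++ v₂)) :
    FirstLess W v₁ ∨ ∃ W', W = v₁ ++ W' ∧ FirstLess W' v₂ := by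
  rcases firstLess_or_prefix W v₁ with h' | h' | h' | ⟨W', rfl⟩
  · exact Or.inl h'
  · exact absurd (h.trans (h'.mono (List.prefix_append _ _) List.prefix_rfl))
      (firstLess_irrefl W)
  · exact absurd (h.mono (h'.trans (List.prefix_append _ v₂)) List.prefix_rfl)
      (firstLess_irrefl _)
  · exact Or.inr ⟨W', rfl, firstLess_append_left.1 h⟩

theorem FirstLess.lt {u v : List α} (h : FirstLess u v) : u < v := by
  obtain ⟨q, a, b, hab, ⟨u', rfl⟩, ⟨v', rfl⟩⟩ := h
  rw [List.append_assoc, List.append_assoc]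
  exact List.Lex.append_left _ (List.Lex.rel hab) q

theorem lt_of_prefix_of_ne {u v : List α} (h : u <+: v) (hne : u ≠ v) : u < v := by
  obtain ⟨t, rfl⟩ := h
  cases t with
  | nil => simp at hne
  | cons x t =>
    have := List.Lex.append_left (· < ·) (List.Lex.nil (a := x) (l := t)) u
    rwa [List.append_nil] at this

/-- A Lyndon word of length at least two is a product of two Lyndon words. The second factor is the
smallest proper suffix. -/
theorem IsLyndon.exists_factorization {v : List α} (hv : IsLyndon v) (hl : 1 < v.length) :
    ∃ v₁ v₂, v = v₁ ++ v₂ ∧ IsLyndon v₁ ∧ IsLyndon v₂ := by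
  classical
  obtain ⟨x, t, rfl⟩ : ∃ x t, v = x :: t := by
    cases v with
    | nil => simp at hl
    | cons x t => exact ⟨x, t, rfl⟩
  have ht : t ≠ [] := by rintro rfl; simp at hl
  let S : Finset (List α) := t.tails.toFinset.erase []
  have hS : ∀ {r}, r ∈ S ↔ r ≠ [] ∧ r <:+ t := by simp [S]
  obtain ⟨v₂, hv₂, hmin⟩ := S.exists_min_image id ⟨t, hS.2 ⟨ht, List.suffix_rfl⟩⟩
  obtain ⟨hne, ⟨t₁, rfl⟩⟩ := hS.1 hv₂
  refine ⟨x :: t₁, v₂, rfl, ⟨by simp, ?_⟩, ⟨hne, ?_⟩⟩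
  · intro p r hp hr h
    have h₁ : FirstLess (x :: t₁ ++ v₂) (r ++ v₂) := by
      refine hv.2 p (r ++ v₂) hp (by simp [hr]) ?_
      rw [← List.append_assoc, ← h]; rfl
    have hlen := congrArg List.length h
    have hp' := List.length_pos_iff.2 hp
    rw [List.length_append] at hlen
    rcases firstLess_or_prefix (x :: t₁) r with h' | h' | h' | ⟨s, hs⟩
    · exact h'
    · exact absurd (h₁.trans (h'.mono (List.prefix_append _ _) (List.prefix_append _ _)))
        (firstLess_irrefl _)
    · have := h'.length_le
      omega
    · rw [← hs, List.append_assoc, firstLess_append_left] at h₁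
      refine absurd h₁.lt (not_lt.2 (hmin _ (hS.2 ⟨by simp [hne], ?_⟩)))
      have h₂ : r ++ s <:+ x :: t₁ := by rw [hs]
      have h₃ : s <:+ x :: t₁ := (List.suffix_append r s).trans h₂
      have h₄ : s <:+ t₁ := by
        rcases List.suffix_cons_iff.1 h₃ with h₅ | h₅
        · have := congrArg List.length hs
          have h₆ := congrArg List.length h₅
          have h₇ := List.length_pos_iff.2 hr
          rw [List.length_append] at this
          omega
        · exact h₅
      obtain ⟨w, rfl⟩ := h₄
      exact ⟨w, by simp⟩
  · intro p r hp hr h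
    have hlen := congrArg List.length h
    have hp' := List.length_pos_iff.2 hp
    rw [List.length_append] at hlen
    have hle : v₂ ≤ r := hmin r (hS.2 ⟨hr, ⟨t₁ ++ p, by rw [h]; simp⟩⟩)
    rcases firstLess_or_prefix v₂ r with h' | h' | h' | h'
    · exact h'
    · exact absurd h'.lt (not_lt.2 hle)
    · have := h'.length_le
      omega
    · refine absurd (lt_of_prefix_of_ne h' ?_) (not_lt.2 hle)
      rintro rfl
      omega

/-- `s` is a smallest word of its length in the language `S`. -/
def IsLeastWord (S : Set (List α)) (s : List α) : Prop :=
  s ∈ S ∧ ∀ u ∈ S, u.length = s.length → ¬ FirstLess u s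

theorem IsLanguage.exists_leastWord_extension [Finite α] {S : Set (List α)} (hS : IsLanguage S)
    {s : List α} (hs : IsLeastWord S s) (N : ℕ) :
    ∃ t, IsLeastWord S (s ++ t) ∧ t.length = N := by
  induction N with
  | zero => exact ⟨[], by simpa using hs, rfl⟩
  | succ N ih =>
    obtain ⟨t, ⟨htS, ht⟩, rfl⟩ := ih
    obtain ⟨a, ha, hmin⟩ := (Set.toFinite {a | s ++ t ++ [a] ∈ S}).exists_minimal
      (hS.extend htS)
    refine ⟨t ++ [a], ⟨by simpa using ha, fun u hu hl h => ?_⟩, by simp⟩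
    rw [← List.append_assoc] at h hl
    have hne : u ≠ [] := by rintro rfl; simp at hl
    obtain ⟨u', b, rfl⟩ : ∃ u' b, u = u' ++ [b] :=
      ⟨_, _, (List.dropLast_append_getLast hne).symm⟩
    have hl' : u'.length = (s ++ t).length := by
      simp only [List.length_append, List.length_singleton] at hl ⊢
      omega
    rcases h.append_cases with ⟨q, x, y, hxy, h₁, h₂⟩ | ⟨W, hW, h'⟩
    · refine ht u' (hS.left_mem hu) hl' ⟨q, x, y, hxy, ?_, h₂⟩
      refine List.prefix_of_prefix_length_le h₁ (List.prefix_append _ _) ?_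
      have := h₂.length_le
      simp only [List.length_append, List.length_singleton] at this hl' ⊢
      omega
    · obtain ⟨rfl, rfl⟩ := List.append_inj hW hl'
      have hba : b < a := by
        have := h'.lt
        simpa [List.cons_lt_cons_iff] using this
      exact absurd (hmin hu hba.le) (not_le.2 hba)

/-- A language over a finite alphabet contains a word of the form `x x`, `x v x` or `r y r`, where
`x` and `y` are letters and `v` and `r` are Lyndon words.

Otherwise take a minimal sublanguage `T` and a least word `s` of `T`, and prolong `s` to a long least
word `s ++ t`. By recurrence `s` occurs again in it; let `v ++ [x]` be what precedes the first such
occurrence. If the letter `x` could precede all of `s ++ t`, then `x x` (if `v` is empty) or `x v x` (if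
`v` is Lyndon) would occur. If `v` is not Lyndon, then leastness of `s` forces a Lyndon suffix `r` of `v`
to be a prefix of `s`, and `r x r` occurs. So `x` can precede `s` but not `s ++ t`, and repeating this
exhausts the letters. -/
theorem IsLanguage.exists_sandwich [Finite α] {S : Set (List α)} (hS : IsLanguage S) :
    (∃ x, [x, x] ∈ S) ∨ (∃ x v, IsLyndon v ∧ x :: (v ++ [x]) ∈ S) ∨
      ∃ r y, IsLyndon r ∧ r ++ y :: r ∈ S := by
  obtain ⟨T, hTS, hT, hmin⟩ := hS.exists_minimal
  by_contra! hcon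
  obtain ⟨hxx, hxvx, hryr⟩ := hcon
  -- the letters which may precede `s` become fewer and fewer as `s` grows
  suffices H : ∀ k, ∀ s, IsLeastWord T s → {x | x :: s ∈ T}.ncard = k → False from
    H _ [] ⟨hT.nil_mem, fun u _ hu h => by
      obtain rfl : u = [] := by simpa using hu
      exact firstLess_irrefl _ h⟩ rfl
  intro k
  induction k using Nat.strong_induction_on with
  | _ k ih =>
  rintro s hs rfl
  obtain ⟨N, hN⟩ := hT.exists_recurrence hmin hs.1
  obtain ⟨t, ht, htl⟩ := hT.exists_leastWord_extension hs (N + 1)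
  -- `p` is the shortest nonempty word such that `p ++ s` is a prefix of `s ++ t`
  have hex : ∃ n, ∃ p q, p.length = n ∧ p ≠ [] ∧ s ++ t = p ++ s ++ q := by
    cases h : s ++ t with
    | nil =>
      have := congrArg List.length h
      rw [List.length_append, htl, List.length_nil] at this
      omega
    | cons z w =>
      have hw : w ∈ T := hT.right_mem (u := [z]) (by rw [List.singleton_append, ← h]; exact ht.1)
      have := congrArg List.length h
      obtain ⟨p, q, hpq⟩ := hN w hw (by simp at this; omega)
      exact ⟨_, z :: p, q, rfl, by simp, by simp [← hpq]⟩
  classical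
  obtain ⟨p, q, hpl, hp, hpq⟩ := Nat.find_spec hex
  have hpmin : ∀ p' q', p' ≠ [] → s ++ t = p' ++ s ++ q' → p.length ≤ p'.length := by
    intro p' q' h₁ h₂
    rw [hpl]
    exact Nat.find_min' hex ⟨p', q', rfl, h₁, h₂⟩
  obtain ⟨v, x, rfl⟩ : ∃ v x, p = v ++ [x] := ⟨_, _, (List.dropLast_append_getLast hp).symm⟩
  have hxs : x :: s ∈ T := hT.infix_mem ⟨v, q, by simp⟩ (hpq ▸ ht.1)
  refine ih _ (Set.ncard_lt_ncard (t := {x | x :: s ∈ T}) ⟨?_, fun hsub => ?_⟩ (Set.toFinite _)) _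
    ht rfl
  · intro y hy
    exact hT.left_mem (u := y :: s) (v := t) hy
  have hxT : x :: (v ++ [x] ++ s ++ q) ∈ T := hpq ▸ hsub hxs
  rcases eq_or_ne v [] with rfl | hv
  · exact hxx x (hTS (hT.left_mem (u := [x, x]) (v := s ++ q) (by simpa using hxT)))
  by_cases hvL : IsLyndon v
  · exact hxvx x v hvL (hTS (hT.left_mem (u := x :: (v ++ [x])) (v := s ++ q) (by simpa using hxT)))
  -- let `r` be the shortest suffix of `v` not larger than `v`; it is a prefix of `s`
  have hex' : ∃ n, ∃ p r, r.length = n ∧ p ≠ [] ∧ r ≠ [] ∧ v = p ++ r ∧ ¬ FirstLess v r := by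
    by_contra! h
    refine hvL ⟨hv, fun p r hp hr hpr => ?_⟩
    by_contra h'
    exact h' (h _ p r rfl hp hr hpr)
  obtain ⟨p, r, hrl, hp, hr, hvpr, hvr⟩ := Nat.find_spec hex'
  have hrmin : ∀ p' r', p' ≠ [] → r' ≠ [] → v = p' ++ r' → r'.length < r.length →
      FirstLess v r' := by
    intro p' r' h₁ h₂ h₃ h₄
    by_contra h₅
    rw [hrl] at h₄
    exact Nat.find_min hex' h₄ ⟨p', r', rfl, h₁, h₂, h₃, h₅⟩
  have hpl' := List.length_pos_iff.2 hp
  have hvl : v.length = p.length + r.length := by rw [hvpr, List.length_append]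
  have hvst : v <+: s ++ t := ⟨[x] ++ s ++ q, by rw [hpq]; simp⟩
  have hrxs : r ++ x :: s ∈ T := by
    refine hT.infix_mem ⟨p, q, ?_⟩ (hpq ▸ ht.1)
    simp [hvpr]
  set u := (r ++ x :: s).take s.length with hu
  have hupre : u <+: r ++ x :: s := List.take_prefix _ _
  have hul : u.length = s.length := by simp [hu]; omega
  have huT : u ∈ T := by
    obtain ⟨w, hw⟩ := hupre
    exact hT.left_mem (v := w) (hw ▸ hrxs)
  have hus : u ≠ s := by
    intro h
    obtain ⟨w, hw⟩ := hupre
    have := hpmin p (w ++ q) hp (by rw [hpq, hvpr, ← h]; simp [← hw, h])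
    simp at this
    omega
  obtain ⟨q', a, b, hab, h₁, h₂⟩ := firstLess_of_length_eq hul hus (hs.2 u huT hul)
  have h₂' := h₂.trans hupre
  have hs_st : s <+: s ++ t := List.prefix_append s t
  have hrs : r <+: s := by
    rcases lt_or_ge q'.length r.length with hlt | hge
    · refine absurd ⟨q', a, b, hab, ?_, ?_⟩ hvr
      · exact List.prefix_of_prefix_length_le (h₁.trans hs_st) hvst (by simp; omega)
      · exact List.prefix_of_prefix_length_le h₂' (List.prefix_append _ _) (by simp; omega)
    · have h₃ : r <+: q' := List.prefix_of_prefix_length_le (List.prefix_append r (x :: s))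
        ((List.prefix_append q' [b]).trans h₂') hge
      exact h₃.trans ((List.prefix_append q' [a]).trans h₁)
  have hrv : r <+: v := List.prefix_of_prefix_length_le (hrs.trans hs_st) hvst (by omega)
  have hrL : IsLyndon r := by
    refine ⟨hr, fun p' r' hp' hr' h => ?_⟩
    have hl' := congrArg List.length h
    have hpl'' := List.length_pos_iff.2 hp'
    rw [List.length_append] at hl'
    obtain ⟨q₁, a₁, b₁, hab₁, h₃, h₄⟩ := hrmin (p ++ p') r' (by simp [hp']) hr'
      (by rw [hvpr, h]; simp) (by omega)
    refine ⟨q₁, a₁, b₁, hab₁, List.prefix_of_prefix_length_le h₃ hrv ?_, h₄⟩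
    have := h₄.length_le
    simp only [List.length_append, List.length_singleton] at this ⊢
    omega
  obtain ⟨w, rfl⟩ := hrs
  exact hryr r x hrL (hTS (hT.left_mem (v := w) (by simpa using hrxs)))

end

/-! ### Greedy iterated commutators -/

section

variable {G : Type*} [Group G] {ι : Type*}

/-- The iterated commutator of `e` with the elements `b c`, where `c` runs through the letters of a
word. -/
def iterComm (b : ι → G) (e : G) (w : List ι) : G :=
  w.foldl (fun e c => ⁅b c, e⁆) e

theorem iterComm_append (b : ι → G) (e : G) (u v : List ι) :
    iterComm b e (u ++ v) = iterComm b (iterComm b e u) v := by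
  simp [iterComm]

theorem iterComm_mem {b : ι → G} {X : Set G}
    (hc : ∀ {a b}, a ∈ X → b ∈ X → ⁅a, b⁆ ∈ X) (hb : ∀ c, b c ∈ X) {e : G} (he : e ∈ X) (w : List ι) :
    iterComm b e w ∈ X := by
  induction w generalizing e with
  | nil => exact he
  | cons c w ih => exact ih (hc (hb c) he)

variable [LinearOrder ι]

/-- The word `w` is *greedy* for `e` if, in forming `iterComm b e w`, at each step the largest letter
`c` is taken for which `b c` does not commute with the element obtained so far. -/
def IsGreedy (b : ι → G) : G → List ι → Prop
  | _, [] => True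
  | e, c :: w => (∀ d, c < d → Commute (b d) e) ∧ ¬ Commute (b c) e ∧ IsGreedy b ⁅b c, e⁆ w

/-- `IsBracketing b v g` says that `g` arises from the word `v` by a bracketing into commutators in
which each factor split off on the right is larger than the word it is split off from. -/
inductive IsBracketing (b : ι → G) : List ι → G → Prop
  | letter (c : ι) : IsBracketing b [c] (b c)
  | comm {v₁ v₂ : List ι} {g₁ g₂ : G} : IsBracketing b v₁ g₁ → IsBracketing b v₂ g₂ →
      FirstLess (v₁ ++ v₂) v₂ → IsBracketing b (v₁ ++ v₂) ⁅g₂, g₁⁆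

theorem IsLyndon.exists_isBracketing (b : ι → G) {v : List ι} (hv : IsLyndon v) :
    ∃ g, IsBracketing b v g := by
  induction hn : v.length using Nat.strong_induction_on generalizing v with
  | _ n ih =>
  rcases Nat.lt_or_ge 1 v.length with hl | hl
  · obtain ⟨v₁, v₂, rfl, h₁, h₂⟩ := hv.exists_factorization hl
    have l₁ := List.length_pos_iff.2 h₁.1
    have l₂ := List.length_pos_iff.2 h₂.1
    rw [List.length_append] at hn
    obtain ⟨g₁, hg₁⟩ := ih _ (by omega) h₁ rfl
    obtain ⟨g₂, hg₂⟩ := ih _ (by omega) h₂ rfl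
    exact ⟨_, .comm hg₁ hg₂ (hv.2 v₁ v₂ h₁.1 h₂.1 rfl)⟩
  · have := List.length_pos_iff.2 hv.1
    obtain ⟨c, rfl⟩ := List.length_eq_one_iff.1 (show v.length = 1 by omega)
    exact ⟨_, .letter c⟩

variable {b : ι → G}

theorem isGreedy_append {e : G} {u v : List ι} :
    IsGreedy b e (u ++ v) ↔ IsGreedy b e u ∧ IsGreedy b (iterComm b e u) v := by
  induction u generalizing e with
  | nil => simp [IsGreedy, iterComm]
  | cons c u ih =>
    rw [List.cons_append, IsGreedy, IsGreedy, ih]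
    simp only [iterComm, List.foldl_cons]
    tauto

theorem IsGreedy.iterComm_ne_one {e : G} {w : List ι} (h : IsGreedy b e w) (he : e ≠ 1) :
    iterComm b e w ≠ 1 := by
  induction w generalizing e with
  | nil => exact he
  | cons c w ih => exact ih h.2.2 fun h' => h.2.1 (commutatorElement_eq_one_iff_commute.1 h')

section

variable {X : Set G} (hX : IsSandwichSet X) (hc : ∀ {a b}, a ∈ X → b ∈ X → ⁅a, b⁆ ∈ X)
  (hb : ∀ c, b c ∈ X)

include hc hb

theorem IsBracketing.mem {v : List ι} {g : G} (h : IsBracketing b v g) : g ∈ X := by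
  induction h with
  | letter c => exact hb c
  | comm _ _ _ h₁ h₂ => exact hc h₂ h₁

include hX

/-- If `W` is greedy for `e`, then `e` commutes with the bracketings of the words larger than `W`,
and for a word `v` with which `W` begins, iterated commutation of `e` with the letters of `v` amounts
to commutation with a bracketing of `v`. -/
theorem IsBracketing.greedy {v : List ι} {g : G} (h : IsBracketing b v g) :
    ∀ e ∈ X, (∀ W, IsGreedy b e W → FirstLess W v → Commute g e) ∧
      (IsGreedy b e v → iterComm b e v = ⁅g, e⁆) := by
  induction h with
  | letter c =>
    refine fun e he => ⟨?_, fun _ => rfl⟩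
    rintro W hW ⟨q, x, y, hxy, h₁, h₂⟩
    have hq : q = [] := by
      have := h₂.length_le
      simpa using this
    subst hq
    obtain ⟨W', rfl⟩ := h₁
    obtain rfl : y = c := by simpa using h₂
    exact hW.1 y hxy
  | @comm v₁ v₂ g₁ g₂ h₁ h₂ hl ih₁ ih₂ =>
    have hg₁ := h₁.mem hc hb
    have hg₂ := h₂.mem hc hb
    refine fun e he => ⟨fun W hW hWv => ?_, fun hv => ?_⟩
    · have c₂ : Commute g₂ e := (ih₂ e he).1 W hW (hWv.trans hl)
      rcases hWv.append_cases with h' | ⟨W', rfl, h'⟩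
      · have c₁ : Commute g₁ e := (ih₁ e he).1 W hW h'
        rw [commutatorElement_def]
        exact ((c₂.mul_left c₁).mul_left c₂.inv_left).mul_left c₁.inv_left
      · rw [isGreedy_append] at hW
        have e₁ := (ih₁ e he).2 hW.1
        have c₃ := (ih₂ _ (iterComm_mem hc hb he v₁)).1 W' hW.2 h'
        rw [e₁, ← commutatorElement_eq_one_iff_commute, hX.comm_comm_eq hc he hg₁ hg₂ c₂] at c₃
        exact commutatorElement_eq_one_iff_commute.1 c₃
    · have c₂ : Commute g₂ e := (ih₂ e he).1 _ hv hl
      rw [isGreedy_append] at hv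
      rw [iterComm_append, (ih₂ _ (iterComm_mem hc hb he v₁)).2 hv.2, (ih₁ e he).2 hv.1,
        hX.comm_comm_eq hc he hg₁ hg₂ c₂]

/-- A greedy word cannot contain `u ++ v ++ u` if `u` and `v` have bracketings `g` and `h`: it would
produce the element `⁅g, ⁅h, ⁅g, e⁆⁆⁆`, which is trivial by the sandwich property. -/
theorem not_isGreedy_sandwich {e : G} (he : e ∈ X) {u v : List ι} {g h : G}
    (hu : IsBracketing b u g) (hv : IsBracketing b v h) (hne : e ≠ 1) :
    ¬ IsGreedy b e (u ++ v ++ u) := by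
  intro hgr
  have hne' := hgr.iterComm_ne_one hne
  rw [isGreedy_append, isGreedy_append] at hgr
  rw [iterComm_append, (hu.greedy hX hc hb _ (iterComm_mem hc hb he _)).2 hgr.2, iterComm_append,
    (hv.greedy hX hc hb _ (iterComm_mem hc hb he _)).2 hgr.1.2,
    (hu.greedy hX hc hb _ he).2 hgr.1.1] at hne'
  exact hne' (commutatorElement_eq_one_iff_commute.2
    (hX.commute_sandwich he (hu.mem hc hb) (hv.mem hc hb)))

/-- A nontrivial group generated by finitely many elements of a sandwich set closed under
commutators has a nontrivial centre: if the centre is trivial, then each greedy word can be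
prolonged, so that the greedy words form a language, contrary to `not_isGreedy_sandwich`. -/
theorem eq_one_of_center_eq_bot [Finite ι] (hgen : Subgroup.closure (Set.range b) = ⊤)
    (hZ : Subgroup.center G = ⊥) (c : ι) : b c = 1 := by
  by_contra hne
  have hS : IsLanguage {w | ∃ e ∈ X, e ≠ 1 ∧ IsGreedy b e w} := by
    refine ⟨⟨b c, hb c, hne, trivial⟩, ?_, ?_, ?_⟩
    · rintro u v ⟨e, he, h1, h⟩
      exact ⟨e, he, h1, (isGreedy_append.1 h).1⟩
    · rintro u v ⟨e, he, h1, h⟩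
      rw [isGreedy_append] at h
      exact ⟨_, iterComm_mem hc hb he u, h.1.iterComm_ne_one h1, h.2⟩
    · rintro u ⟨e, he, h1, h⟩
      have hnc : ∃ d, ¬ Commute (b d) (iterComm b e u) := by
        by_contra! hcon
        refine h.iterComm_ne_one h1 ?_
        have : iterComm b e u ∈ Subgroup.center G := by
          rw [← Subgroup.centralizer_univ, ← Subgroup.coe_top, ← hgen,
            Subgroup.centralizer_closure, Subgroup.mem_centralizer_iff]
          rintro _ ⟨d, rfl⟩
          exact hcon d
        rwa [hZ, Subgroup.mem_bot] at this
      obtain ⟨d, hd, hmax⟩ := (Set.toFinite {d | ¬ Commute (b d) (iterComm b e u)}).exists_maximal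
        hnc
      refine ⟨d, e, he, h1, isGreedy_append.2 ⟨h, fun d' hd' => ?_, hd, trivial⟩⟩
      by_contra h'
      exact absurd (hmax h' hd'.le) (not_le.2 hd')
  rcases hS.exists_sandwich with ⟨x, e, he, h1, h⟩ | ⟨x, v, hv, e, he, h1, h⟩ |
    ⟨r, y, hr, e, he, h1, h⟩
  · exact h.2.2.2.1 (hX.commute_comm_left (hb x) he)
  · obtain ⟨g, hg⟩ := hv.exists_isBracketing b
    exact not_isGreedy_sandwich hX hc hb he (.letter x) hg h1 (by simpa using h)
  · obtain ⟨g, hg⟩ := hr.exists_isBracketing b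
    exact not_isGreedy_sandwich hX hc hb he hg (.letter y) h1 (by simpa using h)

end
end

/-! ### Nilpotency of finitely generated groups -/

section

variable {G : Type*} [Group G]

theorem IsSandwichSet.image_of_surjective {H : Type*} [Group H] {X : Set G} (hX : IsSandwichSet X)
    {f : G →* H} (hf : Function.Surjective f) : IsSandwichSet (f '' X) := by
  refine ⟨⟨1, hX.one_mem', map_one f⟩, ?_, ?_, ?_⟩
  · rintro _ ⟨x, hx, rfl⟩
    exact ⟨_, hX.inv_mem' hx, map_inv f x⟩
  · rintro _ ⟨x, hx, rfl⟩ h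
    obtain ⟨g, rfl⟩ := hf h
    exact ⟨_, hX.conj_mem' hx g, by simp⟩
  · rintro _ _ _ ⟨x, hx, rfl⟩ ⟨u, hu, rfl⟩ ⟨v, hv, rfl⟩
    simpa using (hX.commute' hx hu hv).map f

theorem IsSandwichSet.preimage_of_injective {H : Type*} [Group H] {X : Set G}
    (hX : IsSandwichSet X) {f : H →* G} (hf : Function.Injective f) :
    IsSandwichSet (f ⁻¹' X) := by
  refine ⟨?_, fun {x} hx => ?_, fun {x} hx g => ?_, fun {x u v} hx hu hv => ?_⟩
  · simpa using hX.one_mem'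
  · simpa using hX.inv_mem' hx
  · simpa using hX.conj_mem' hx (f g)
  · refine Commute.of_map hf ?_
    simpa using hX.commute' hx hu hv

theorem exists_forall_mem_of_mem_iSup_upperCentralSeries {ι : Type*} [Finite ι] {f : ι → G}
    (hf : ∀ i, f i ∈ ⨆ n, Subgroup.upperCentralSeries G n) :
    ∃ n, ∀ i, f i ∈ Subgroup.upperCentralSeries G n := by
  have hm := Subgroup.upperCentralSeries_mono G
  have h : ∀ i, ∃ n, f i ∈ Subgroup.upperCentralSeries G n := fun i =>
    (Subgroup.mem_iSup_of_directed hm.directed_le).1 (hf i)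
  choose k hk using h
  obtain ⟨n, hn⟩ := (Set.finite_range k).bddAbove
  exact ⟨n, fun i => hm (hn ⟨i, rfl⟩) (hk i)⟩

/-- Modulo its hypercentre of height `ω`, a finitely generated group has trivial centre. -/
theorem center_quotient_iSup_upperCentralSeries {ι : Type*} [Finite ι] {b : ι → G}
    (hgen : Subgroup.closure (Set.range b) = ⊤)
    [(⨆ n, Subgroup.upperCentralSeries G n).Normal] :
    Subgroup.center (G ⧸ ⨆ n, Subgroup.upperCentralSeries G n) = ⊥ := by
  refine (Subgroup.eq_bot_iff_forall _).2 fun q hq => ?_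
  obtain ⟨g, rfl⟩ := QuotientGroup.mk_surjective q
  have h : ∀ i, ⁅b i, g⁆ ∈ ⨆ n, Subgroup.upperCentralSeries G n := fun i => by
    rw [← QuotientGroup.eq_one_iff, ← QuotientGroup.mk'_apply, map_commutatorElement,
      commutatorElement_eq_one_iff_commute]
    exact Subgroup.mem_center_iff.1 hq _
  obtain ⟨n, hn⟩ := exists_forall_mem_of_mem_iSup_upperCentralSeries h
  rw [QuotientGroup.eq_one_iff]
  refine Subgroup.mem_iSup_of_mem (n + 1) (Subgroup.mem_upperCentralSeries_succ_iff.2 ?_)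
  -- the elements commuting with `g` modulo the `n`-th centre form a subgroup
  have hle : Subgroup.closure (Set.range b) ≤
      (Subgroup.centralizer {(g : G ⧸ Subgroup.upperCentralSeries G n)}).comap
        (QuotientGroup.mk' _) := by
    rw [Subgroup.closure_le]
    rintro _ ⟨i, rfl⟩
    refine Subgroup.mem_comap.2 (Subgroup.mem_centralizer_singleton_iff.2 ?_)
    have := hn i
    rw [← QuotientGroup.eq_one_iff, ← QuotientGroup.mk'_apply, map_commutatorElement,
      commutatorElement_eq_one_iff_commute] at this
    exact this
  intro y
  have hy : y ∈ Subgroup.closure (Set.range b) := hgen ▸ Subgroup.mem_top y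
  have := Subgroup.mem_centralizer_singleton_iff.1 (Subgroup.mem_comap.1 (hle hy))
  rw [← QuotientGroup.eq_one_iff, ← QuotientGroup.mk'_apply, map_commutatorElement,
    commutatorElement_eq_one_iff_commute]
  exact this.symm

/-- A group generated by finitely many elements of a sandwich set closed under commutators is
nilpotent. -/
theorem IsSandwichSet.isNilpotent {ι : Type*} [LinearOrder ι] [Finite ι] {X : Set G} {b : ι → G}
    (hX : IsSandwichSet X) (hc : ∀ {a b}, a ∈ X → b ∈ X → ⁅a, b⁆ ∈ X) (hb : ∀ i, b i ∈ X)
    (hgen : Subgroup.closure (Set.range b) = ⊤) : Group.IsNilpotent G := by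
  have hN : (⨆ n, Subgroup.upperCentralSeries G n).Normal := inferInstance
  set π := QuotientGroup.mk' (⨆ n, Subgroup.upperCentralSeries G n) with hπ
  have hs : Function.Surjective π := QuotientGroup.mk'_surjective _
  have h : ∀ i, b i ∈ ⨆ n, Subgroup.upperCentralSeries G n := fun i => by
    rw [← QuotientGroup.eq_one_iff]
    refine eq_one_of_center_eq_bot (b := fun i => π (b i)) (hX.image_of_surjective hs) ?_
      (fun i => ⟨b i, hb i, rfl⟩) ?_ (center_quotient_iSup_upperCentralSeries hgen) i
    · rintro _ _ ⟨x, hx, rfl⟩ ⟨y, hy, rfl⟩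
      exact ⟨_, hc hx hy, map_commutatorElement π x y⟩
    · rw [show Set.range (fun i => π (b i)) = π '' Set.range b from Set.range_comp π b,
        ← MonoidHom.map_closure, hgen, Subgroup.map_top_of_surjective π hs]
  obtain ⟨n, hn⟩ := exists_forall_mem_of_mem_iSup_upperCentralSeries h
  refine ⟨n, top_le_iff.1 ?_⟩
  rw [← hgen, Subgroup.closure_le]
  rintro _ ⟨i, rfl⟩
  exact hn i

end

/-! ### Strong left 3-Engel elements -/

section

variable {G : Type*} [Group G]

theorem commute_comm_of_comm_mem_center {x u z : G} (hx : ⁅z, x⁆ ∈ Subgroup.center G)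
    (hu : ⁅z, u⁆ ∈ Subgroup.center G) : Commute z ⁅x, u⁆ := by
  have e : z * ⁅x, u⁆ * z⁻¹ = ⁅x, u⁆ := by
    calc z * ⁅x, u⁆ * z⁻¹ = ⁅⁅z, x⁆ * x, ⁅z, u⁆ * u⁆ := by
          simp only [commutatorElement_def]; group
      _ = ⁅z, x⁆ * (x * (⁅z, u⁆ * u) * x⁻¹ * ⁅z, x⁆⁻¹) * (⁅z, u⁆ * u)⁻¹ := by
          rw [commutatorElement_def (⁅z, x⁆ * x)]; group
      _ = x * ⁅z, u⁆ * (u * x⁻¹ * u⁻¹) * ⁅z, u⁆⁻¹ := by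
          rw [Subgroup.mem_center_iff.1 (inv_mem hx)]; group
      _ = x * (u * x⁻¹ * u⁻¹) := by
          rw [mul_assoc x, ← Subgroup.mem_center_iff.1 hu]; group
      _ = _ := by rw [commutatorElement_def]; group
  exact mul_inv_eq_iff_eq_mul.1 e

theorem NilpotentOfClassAtMost.commute_comm {H : Subgroup G} (hH : NilpotentOfClassAtMost H 2)
    {x u : G} (hx : x ∈ H) (hu : u ∈ H) : Commute x ⁅u, x⁆ := by
  obtain ⟨hn, hc⟩ := hH
  have ht := Subgroup.upperCentralSeries_eq_top_iff_nilpotencyClass_le.2 hc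
  have h : ∀ p q : H, ⁅p, q⁆ ∈ Subgroup.center H := fun p q => by
    rw [← Subgroup.upperCentralSeries_one]
    exact Subgroup.mem_upperCentralSeries_succ_iff.1 (ht ▸ Subgroup.mem_top p) q
  exact Commute.map (Subgroup.mem_center_iff.1 (h ⟨u, hu⟩ ⟨x, hx⟩) ⟨x, hx⟩) H.subtype

theorem NilpotentOfClassAtMost.commute_comm_comm {H : Subgroup G}
    (hH : NilpotentOfClassAtMost H 3) {x u v : G} (hx : x ∈ H) (hu : u ∈ H) (hv : v ∈ H) :
    Commute ⁅u, x⁆ ⁅v, x⁆ := by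
  obtain ⟨hn, hc⟩ := hH
  have ht := Subgroup.upperCentralSeries_eq_top_iff_nilpotencyClass_le.2 hc
  have h : ∀ p q r : H, ⁅⁅p, q⁆, r⁆ ∈ Subgroup.center H := fun p q r => by
    rw [← Subgroup.upperCentralSeries_one]
    exact Subgroup.mem_upperCentralSeries_succ_iff.1
      (Subgroup.mem_upperCentralSeries_succ_iff.1 (ht ▸ Subgroup.mem_top p) q) r
  exact (commute_comm_of_comm_mem_center (h ⟨u, hu⟩ ⟨x, hx⟩ ⟨v, hv⟩)
    (h ⟨u, hu⟩ ⟨x, hx⟩ ⟨x, hx⟩)).map H.subtype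

/-- The conjugates of the powers of a strong left 3-Engel element form a sandwich set. -/
theorem IsStrongLeftThreeEngel.isSandwichSet {a : G} (ha : IsStrongLeftThreeEngel a) :
    IsSandwichSet {x | ∃ (g : G) (n : ℤ), x = g * a ^ n * g⁻¹} := by
  have key : ∀ (f g : G) (m n : ℤ), Commute (rightConj a f ^ m * a * (rightConj a f ^ m)⁻¹)
      (rightConj a g ^ n * a * (rightConj a g ^ n)⁻¹) := by
    intro f g m n
    have hcl : ∀ (f : G) (m : ℤ), Commute a ⁅rightConj a f ^ m, a⁆ := fun f m =>
      (ha.class_two f).commute_comm (Subgroup.subset_closure (by simp))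
        (zpow_mem (Subgroup.subset_closure (by simp)) m)
    have h := (ha.class_three f g).commute_comm_comm (x := a) (u := rightConj a f ^ m)
      (v := rightConj a g ^ n) (Subgroup.subset_closure (by simp))
      (zpow_mem (Subgroup.subset_closure (by simp)) m)
      (zpow_mem (Subgroup.subset_closure (by simp)) n)
    have e : ∀ u : G, u * a * u⁻¹ = ⁅u, a⁆ * a := fun u => by
      rw [commutatorElement_def]; group
    rw [e, e]
    exact (h.mul_right (hcl f m).symm).mul_left ((hcl g n).mul_right (Commute.refl a))
  refine ⟨⟨1, 0, by simp⟩, ?_, ?_, ?_⟩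
  · rintro _ ⟨g, n, rfl⟩
    exact ⟨g, -n, by group⟩
  · rintro _ ⟨g, n, rfl⟩ h
    exact ⟨h * g, n, by group⟩
  · rintro _ _ _ ⟨g, n, rfl⟩ ⟨p, k, rfl⟩ ⟨q, l, rfl⟩
    -- conjugation by `g⁻¹` turns the base into a power of `a` itself
    have e : ∀ (p : G) (k : ℤ), p * a ^ k * p⁻¹ * (g * a ^ n * g⁻¹) * (p * a ^ k * p⁻¹)⁻¹ =
        g * (rightConj a (p⁻¹ * g) ^ k * a * (rightConj a (p⁻¹ * g) ^ k)⁻¹) ^ n * g⁻¹ := by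
      intro p k
      have e₁ : rightConj a (p⁻¹ * g) ^ k = g⁻¹ * p * a ^ k * (g⁻¹ * p)⁻¹ := by
        rw [← conj_zpow]; simp [rightConj, mul_assoc]
      rw [e₁, conj_zpow]
      group
    rw [e, e, Commute.conj_iff]
    exact (key _ _ _ _).zpow_zpow _ _

/-- The passage from nilpotency of the groups generated by finitely many conjugates of `a` to all
finitely generated subgroups of the normal closure. -/
theorem isLocallyNilpotentGroup_normalClosure {a : G}
    (h : ∀ T : Set G, T.Finite → T ⊆ Group.conjugatesOfSet {a} →
      Group.IsNilpotent (Subgroup.closure T)) :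
    IsLocallyNilpotentGroup (Subgroup.normalClosure {a}) := by
  intro K hK
  obtain ⟨S, hS⟩ := hK
  have hfin : ∀ s ∈ Subgroup.normalClosure {a}, ∃ T : Set G, T.Finite ∧
      T ⊆ Group.conjugatesOfSet {a} ∧ s ∈ Subgroup.closure T := by
    intro s hs
    induction hs using Subgroup.closure_induction with
    | mem x hx => exact ⟨{x}, Set.finite_singleton x, by simpa using hx,
        Subgroup.subset_closure rfl⟩
    | one => exact ⟨∅, Set.finite_empty, Set.empty_subset _, one_mem _⟩
    | mul x y _ _ hx hy =>
      obtain ⟨T, hT, hT', hxT⟩ := hx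
      obtain ⟨U, hU, hU', hyU⟩ := hy
      exact ⟨T ∪ U, hT.union hU, Set.union_subset hT' hU',
        mul_mem (Subgroup.closure_mono Set.subset_union_left hxT)
          (Subgroup.closure_mono Set.subset_union_right hyU)⟩
    | inv x _ hx =>
      obtain ⟨T, hT, hT', hxT⟩ := hx
      exact ⟨T, hT, hT', inv_mem hxT⟩
  choose T hTf hTc hT using fun s : Subgroup.normalClosure {a} => hfin s s.2
  have hnil := h (⋃ s ∈ S, T s) (S.finite_toSet.biUnion fun s _ => hTf s)
    (Set.iUnion₂_subset fun s _ => hTc s)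
  have hle : K.map (Subgroup.normalClosure {a}).subtype ≤ Subgroup.closure (⋃ s ∈ S, T s) := by
    rw [← hS, MonoidHom.map_closure, Subgroup.closure_le]
    rintro _ ⟨s, hs, rfl⟩
    exact Subgroup.closure_mono (Set.subset_biUnion_of_mem (u := T) hs) (hT s)
  have h₁ := (Group.isNilpotent_congr (Subgroup.subgroupOfEquivOfLe hle)).1 inferInstance
  exact (Group.isNilpotent_congr
    (K.equivMapOfInjective _ (Subgroup.normalClosure {a}).subtype_injective)).2 h₁

end

theorem theorem1p2 {G : Type*} [Group G] (a : G) (ha : IsStrongLeftThreeEngel a) :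
    IsLocallyNilpotentGroup (Subgroup.normalClosure {a}) := by
  refine isLocallyNilpotentGroup_normalClosure fun T hT hTa => ?_
  obtain ⟨Y, hXY, hY, hc⟩ := ha.isSandwichSet.exists_comm_closed
  have hTY : T ⊆ Y := fun t ht => hXY <| by
    obtain ⟨g, rfl⟩ : ∃ g, g * a * g⁻¹ = t := by
      simpa [Group.conjugatesOfSet, conjugatesOf, isConj_iff] using hTa ht
    exact ⟨g, 1, by simp⟩
  have := hT.to_subtype
  -- any linear order on the generators will do
  obtain ⟨n, ⟨e⟩⟩ := Finite.exists_equiv_fin T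
  refine (hY.preimage_of_injective (Subgroup.closure T).subtype_injective).isNilpotent
    (b := fun i => ⟨e.symm i, Subgroup.subset_closure (e.symm i).2⟩) (fun {p q} hp hq => ?_)
    (fun i => hTY (e.symm i).2) ?_
  · exact hc hp hq
  · rw [← Subgroup.closure_closure_coe_preimage (k := T)]
    congr 1
    ext x
    constructor
    · rintro ⟨i, rfl⟩
      exact (e.symm i).2
    · intro hx
      exact ⟨e ⟨x, hx⟩, by simp⟩
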